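/- Let $K$ be a field, let $A$ be a finite dimensional symmetric $K$-algebra (that is, $A$ has a non-degenerate symmetric bilinear form with $\langle xa,y\rangle=\langle x,ay\rangle$ for all $a,x,y\in A$; in particular $A$ is self-injective), and let $M$ be a finite dimensional faithful right $A$-module. Put $S=\operatorname{End}_A(M)$, acting on $M$ from the left. If $B$ is a $K$-algebra with an anti-automorphism $*$ and $X$ is a right $B$-module, then the dual $X^*=\operatorname{Hom}_K(X,K)$ is a right $B$-module via $(fb)(x)=f(xb^*)$, and $X$ is called self-dual if $X\cong X^*$ as right $B$-modules. Suppose that $A$ is equipped with a $K$-linear anti-involution $*$ and that there is an isomorphism $\theta\colon M\to M^*$ of right $A$-modules, which we fix. Let $*$ also denote the anti-automorphism $s\mapsto s^*$ of $S$ given by $\theta(s^*m)=\theta(m)\circ s$ for $s\in S$ and $m\in M$, and let $M_R$ be the right $S$-module that is $M$ as a vector space, with action $m\cdot s=s^*m$. Suppose that $A$, as a right $A$-module, is a direct summand of $M$, let $e\in S$ be the corresponding projection of $M$ onto $A$, and assume that $e^*=e$. Let $\{L^\lambda\mid\lambda\in\mathcal P\}$ be a complete set of pairwise non-isomorphic simple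 right $S$-modules, let $P^\lambda$ be the projective cover of $L^\lambda$, let $D^\lambda=L^\lambda\otimes_S M$, a right $A$-module, and let $\mathcal K=\{\lambda\in\mathcal P\mid D^\lambda\neq0\}$. Assume that $D^\mu$ is self-dual for every $\mu\in\mathcal K$. Then, for every $\lambda\in\mathcal P$, the following are equivalent: (a) $\lambda\in\mathcal K$; (b) $D^\lambda\neq0$; (c) $L^\lambda$ is isomorphic to a right $S$-submodule of $M_R$; (d) $P^\lambda$ is isomorphic to a direct summand of $M_R$ as a right $S$-module; (e) $P^\lambda$ is a projective and injective right $S$-module; (f) $P^\lambda$ is self-dual as a right $S$-module. -/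

import Mathlib

universe u v w p

open scoped TensorProduct

/-! Right modules over a ring `B` are modules over `Bᵐᵒᵖ`; the right action `x · b` is `op b • x`.
An anti-homomorphism of a `K`-algebra `B` is a `K`-algebra homomorphism `σ : B →ₐ[K] Bᵐᵒᵖ`; it
sends `b` to `b^*` where `σ b = op (b^*)`. -/

namespace SchurPair

section Duality

variable {K : Type*} [Field K] {B : Type*} [Ring B] [Algebra K B]

/-- `σ` is an anti-involution: `(b^*)^* = b`. -/
def IsAntiInvolution (σ : B →ₐ[K] Bᵐᵒᵖ) : Prop :=
  ∀ b : B, (σ (σ b).unop).unop = b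

/-- The `K`-linear endomorphism `x ↦ x · b` of a right `B`-module, for `c = op b`. -/
def rsmul (K : Type*) [Field K] {B : Type*} [Ring B] [Algebra K B]
    (X : Type*) [AddCommGroup X] [Module K X] [Module Bᵐᵒᵖ X] [IsScalarTower K Bᵐᵒᵖ X]
    (c : Bᵐᵒᵖ) : X →ₗ[K] X where
  toFun x := c • x
  map_add' := smul_add c
  map_smul' k x := (smul_comm k c x).symm

/-- The dual `X^* = Hom_K(X, K)` of a right `B`-module `X`. -/
def RDual (_σ : B →ₐ[K] Bᵐᵒᵖ) (X : Type*) [AddCommGroup X] [Module K X] : Type _ :=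
  X →ₗ[K] K

variable (σ : B →ₐ[K] Bᵐᵒᵖ) (X : Type*) [AddCommGroup X] [Module K X]

instance : AddCommGroup (RDual σ X) := inferInstanceAs (AddCommGroup (X →ₗ[K] K))

instance : Module K (RDual σ X) := inferInstanceAs (Module K (X →ₗ[K] K))

/-- The underlying linear form of an element of the dual module. -/
def RDual.form {σ : B →ₐ[K] Bᵐᵒᵖ} {X : Type*} [AddCommGroup X] [Module K X]
    (f : RDual σ X) : X →ₗ[K] K := f

variable [Module Bᵐᵒᵖ X] [IsScalarTower K Bᵐᵒᵖ X]

/-- The right `B`-module structure on the dual: `(f · b)(x) = f (x · b^*)`. -/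
instance : Module Bᵐᵒᵖ (RDual σ X) where
  smul c f := LinearMap.comp f.form (rsmul K X (σ c.unop))
  one_smul f := by
    refine LinearMap.ext fun x => ?_
    change f.form (σ (1 : Bᵐᵒᵖ).unop • x) = f.form x
    simp
  mul_smul c d f := by
    refine LinearMap.ext fun x => ?_
    change f.form (σ (c * d).unop • x) = f.form (σ d.unop • σ c.unop • x)
    simp [mul_smul]
  smul_zero c := by
    refine LinearMap.ext fun x => ?_
    rfl
  smul_add c f g := by
    refine LinearMap.ext fun x => ?_
    rfl
  add_smul c d f := by
    refine LinearMap.ext fun x => ?_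
    change f.form (σ (c + d).unop • x) = f.form (σ c.unop • x) + f.form (σ d.unop • x)
    simp [add_smul]
  zero_smul f := by
    refine LinearMap.ext fun x => ?_
    change f.form (σ (0 : Bᵐᵒᵖ).unop • x) = 0
    simp

theorem RDual.smul_form_apply {σ : B →ₐ[K] Bᵐᵒᵖ} {X : Type*} [AddCommGroup X] [Module K X]
    [Module Bᵐᵒᵖ X] [IsScalarTower K Bᵐᵒᵖ X] (c : Bᵐᵒᵖ) (f : RDual σ X) (x : X) :
    (c • f).form x = f.form (σ c.unop • x) := rfl

/-- A right `B`-module `X` is self-dual if `X ≅ X^*` as right `B`-modules. -/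
def IsSelfDual : Prop := Nonempty (X ≃ₗ[Bᵐᵒᵖ] RDual σ X)

end Duality

section Twist

variable {K : Type*} [Field K] {B : Type*} [Ring B] [Algebra K B]

/-- A left `B`-module `X` turned into the right `B`-module `X_R` with `x · b = b^* x`. -/
def RTwist (_σ : B →ₐ[K] Bᵐᵒᵖ) (X : Type*) : Type _ := X

variable (σ : B →ₐ[K] Bᵐᵒᵖ) (X : Type*) [AddCommGroup X]

instance : AddCommGroup (RTwist σ X) := inferInstanceAs (AddCommGroup X)

/-- The vector in `X_R` given by a vector in `X`. -/
def RTwist.mk {X : Type*} (x : X) : RTwist σ X := x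

/-- The vector in `X` underlying a vector in `X_R`. -/
def RTwist.val {σ : B →ₐ[K] Bᵐᵒᵖ} {X : Type*} (x : RTwist σ X) : X := x

instance [Module B X] : Module Bᵐᵒᵖ (RTwist σ X) where
  smul c x := RTwist.mk σ ((σ c.unop).unop • x.val)
  one_smul x := by
    change (σ (1 : Bᵐᵒᵖ).unop).unop • x.val = x.val
    simp
  mul_smul c d x := by
    change (σ (c * d).unop).unop • x.val = (σ c.unop).unop • (σ d.unop).unop • x.val
    simp [mul_smul]
  smul_zero c := by
    change (σ c.unop).unop • (0 : X) = 0
    simp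
  smul_add c x y := by
    change (σ c.unop).unop • (x.val + y.val) = (σ c.unop).unop • x.val + (σ c.unop).unop • y.val
    simp
  add_smul c d x := by
    change (σ (c + d).unop).unop • x.val = (σ c.unop).unop • x.val + (σ d.unop).unop • x.val
    simp [add_smul]
  zero_smul x := by
    change (σ (0 : Bᵐᵒᵖ).unop).unop • x.val = 0
    simp

end Twist

section Algebras

/-- `A` is a symmetric algebra: it has a non-degenerate symmetric bilinear form with
`⟨x a, y⟩ = ⟨x, a y⟩`. -/
def IsSymmetricAlgebra (K : Type*) [Field K] (A : Type*) [Ring A] [Algebra K A] : Prop :=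
  ∃ β : LinearMap.BilinForm K A, β.Nondegenerate ∧ β.IsSymm ∧
    ∀ a x y : A, β (x * a) y = β x (a * y)

/-- `(A, M)` is a Schur pair over `K`: `A` is a finite dimensional self-injective `K`-algebra and
`M` is a finite dimensional faithful right `A`-module. -/
structure IsSchurPair (K : Type*) [Field K] (A : Type*) [Ring A] [Algebra K A]
    (M : Type*) [AddCommGroup M] [Module K M] [Module Aᵐᵒᵖ M] : Prop where
  finite_algebra : FiniteDimensional K A
  selfInjective : Module.Injective Aᵐᵒᵖ A
  finite_module : FiniteDimensional K M
  faithful : FaithfulSMul Aᵐᵒᵖ M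

/-- The algebra `S_A(M) = End_A(M)` of endomorphisms of the right `A`-module `M`. -/
abbrev SchurAlg (A : Type*) [Ring A] (M : Type*) [AddCommGroup M] [Module Aᵐᵒᵖ M] : Type _ :=
  Module.End Aᵐᵒᵖ M

end Algebras

section Adjoint

variable {K : Type*} [Field K] {A : Type*} [Ring A] [Algebra K A]
  {M : Type*} [AddCommGroup M] [Module K M] [Module Aᵐᵒᵖ M] [IsScalarTower K Aᵐᵒᵖ M]
  {σ : A →ₐ[K] Aᵐᵒᵖ}

/-- `s^τ : M^* → M^*`, `f ↦ f ∘ s`, as an endomorphism of the right `A`-module `M^*`. -/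
def precomp (s : SchurAlg A M) : RDual σ M →ₗ[Aᵐᵒᵖ] RDual σ M where
  toFun f := LinearMap.comp f.form (s.restrictScalars K)
  map_add' f g := by
    refine LinearMap.ext fun x => ?_
    rfl
  map_smul' c f := by
    refine LinearMap.ext fun x => ?_
    have h : s (σ c.unop • x) = σ c.unop • s x := map_smul s _ x
    change f.form (σ c.unop • s x) = f.form (s (σ c.unop • x))
    rw [h]

/-- `s^* = θ⁻¹ ∘ s^τ ∘ θ`, that is `θ (s^* m) = θ m ∘ s`. -/
def adj (θ : M ≃ₗ[Aᵐᵒᵖ] RDual σ M) (s : SchurAlg A M) : SchurAlg A M :=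
  (θ.symm : RDual σ M →ₗ[Aᵐᵒᵖ] M) ∘ₗ precomp s ∘ₗ (θ : M →ₗ[Aᵐᵒᵖ] RDual σ M)

theorem form_adj (θ : M ≃ₗ[Aᵐᵒᵖ] RDual σ M) (s : SchurAlg A M) (m x : M) :
    (θ (adj θ s m)).form x = (θ m).form (s x) := by
  simp only [adj, LinearMap.comp_apply, LinearEquiv.coe_coe, LinearEquiv.apply_symm_apply]
  rfl

theorem adj_unique (θ : M ≃ₗ[Aᵐᵒᵖ] RDual σ M) (s t : SchurAlg A M)
    (h : ∀ m x : M, (θ (t m)).form x = (θ m).form (s x)) : adj θ s = t := by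
  refine LinearMap.ext fun m => θ.injective ?_
  refine LinearMap.ext fun x => ?_
  exact (form_adj θ s m x).trans (h m x).symm

/-- The isomorphism `θ` is `K`-linear. -/
theorem theta_smul (θ : M ≃ₗ[Aᵐᵒᵖ] RDual σ M) (k : K) (m x : M) :
    (θ (k • m)).form x = k * (θ m).form x := by
  have h : k • m = (algebraMap K Aᵐᵒᵖ k) • m := (algebraMap_smul Aᵐᵒᵖ k m).symm
  rw [h, map_smul, RDual.smul_form_apply]
  have h2 : σ (algebraMap K Aᵐᵒᵖ k).unop = algebraMap K Aᵐᵒᵖ k := by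
    rw [MulOpposite.algebraMap_apply, MulOpposite.unop_op]
    exact σ.commutes k
  rw [h2, algebraMap_smul, map_smul, smul_eq_mul]

/-- The anti-automorphism `s ↦ s^*` of `S_A(M)` determined by `θ : M ≅ M^*`. -/
def schurStar (θ : M ≃ₗ[Aᵐᵒᵖ] RDual σ M) : SchurAlg A M →ₐ[K] (SchurAlg A M)ᵐᵒᵖ where
  toFun s := MulOpposite.op (adj θ s)
  map_one' := by
    rw [adj_unique θ 1 1 (fun m x => rfl)]
    rfl
  map_mul' s t := by
    rw [adj_unique θ (s * t) (adj θ t * adj θ s) (fun m x => by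
      rw [Module.End.mul_apply, form_adj, form_adj, Module.End.mul_apply])]
    rfl
  map_zero' := by
    rw [adj_unique θ 0 0 (fun m x => by
      simp only [LinearMap.zero_apply, map_zero]
      rfl)]
    rfl
  map_add' s t := by
    rw [adj_unique θ (s + t) (adj θ s + adj θ t) (fun m x => by
      simp only [LinearMap.add_apply, map_add]
      exact congrArg₂ (· + ·) (form_adj θ s m x) (form_adj θ t m x))]
    rfl
  commutes' k := by
    rw [adj_unique θ (algebraMap K _ k) (algebraMap K _ k) (fun m x => by
      rw [Module.algebraMap_end_apply, Module.algebraMap_end_apply, theta_smul, map_smul,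
        smul_eq_mul])]
    rfl

end Adjoint

section Tensor

variable (K : Type*) [Field K] {B : Type*} [Ring B] [Algebra K B]
  (X : Type*) [AddCommGroup X] [Module K X] [Module Bᵐᵒᵖ X]
  (M : Type*) [AddCommGroup M] [Module K M] [Module B M]

/-- The subspace of `X ⊗_K M` spanned by the elements `x b ⊗ m - x ⊗ b m`. -/
def balancedRel : Submodule K (X ⊗[K] M) :=
  Submodule.span K {z | ∃ (x : X) (b : B) (m : M),
    z = (MulOpposite.op b • x) ⊗ₜ[K] m - x ⊗ₜ[K] (b • m)}

/-- The tensor product `X ⊗_B M` of a right and a left `B`-module. -/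
def BTensor : Type _ := (X ⊗[K] M) ⧸ balancedRel K (B := B) X M

end Tensor

section Functor

variable (K : Type*) [Field K] (A : Type*) [Ring A] [Algebra K A]
  (M : Type*) [AddCommGroup M] [Module K M] [Module Aᵐᵒᵖ M] [IsScalarTower K Aᵐᵒᵖ M]
  (X : Type*) [AddCommGroup X] [Module K X] [Module (SchurAlg A M)ᵐᵒᵖ X]

/-- The functor `F(X) = X ⊗_S M` from right `S`-modules to right `A`-modules, `S = S_A(M)`. -/
def Fun : Type _ := BTensor K (B := SchurAlg A M) X M

instance : AddCommGroup (Fun K A M X) :=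
  inferInstanceAs (AddCommGroup ((X ⊗[K] M) ⧸ balancedRel K (B := SchurAlg A M) X M))

instance : Module K (Fun K A M X) :=
  inferInstanceAs (Module K ((X ⊗[K] M) ⧸ balancedRel K (B := SchurAlg A M) X M))

/-- The canonical map `X ⊗_K M → X ⊗_S M`. -/
def Fun.proj : X ⊗[K] M →ₗ[K] Fun K A M X :=
  Submodule.mkQ (balancedRel K (B := SchurAlg A M) X M)

theorem Fun.proj_surjective : Function.Surjective (Fun.proj K A M X) :=
  Submodule.mkQ_surjective _

/-- The map `x ⊗ m ↦ x ⊗ m a` on `X ⊗_S M`, for `c = op a`. -/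
def Fun.act (c : Aᵐᵒᵖ) : Fun K A M X →ₗ[K] Fun K A M X :=
  Submodule.mapQ (balancedRel K (B := SchurAlg A M) X M) (balancedRel K (B := SchurAlg A M) X M)
    (LinearMap.lTensor X (rsmul K M c)) <| by
      refine Submodule.span_le.2 ?_
      rintro _ ⟨x, b, m, rfl⟩
      refine Submodule.subset_span ⟨x, b, c • m, ?_⟩
      have h : rsmul K M c (b m) = b (c • m) := (map_smul b c m).symm
      simp only [map_sub, LinearMap.lTensor_tmul, Module.End.smul_def, h]
      rfl

theorem Fun.act_proj (c : Aᵐᵒᵖ) (z : X ⊗[K] M) :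
    Fun.act K A M X c (Fun.proj K A M X z) =
      Fun.proj K A M X (LinearMap.lTensor X (rsmul K M c) z) := rfl

/-- The right `A`-module structure `(x ⊗ m) a = x ⊗ m a` on `F(X)`. -/
instance : Module Aᵐᵒᵖ (Fun K A M X) where
  smul c z := Fun.act K A M X c z
  one_smul z := by
    obtain ⟨z, rfl⟩ := Fun.proj_surjective K A M X z
    have h : rsmul K M (1 : Aᵐᵒᵖ) = LinearMap.id := LinearMap.ext fun m => one_smul _ m
    change Fun.act K A M X 1 _ = _
    rw [Fun.act_proj, h, LinearMap.lTensor_id, LinearMap.id_apply]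
  mul_smul c d z := by
    obtain ⟨z, rfl⟩ := Fun.proj_surjective K A M X z
    have h : rsmul K M (c * d) = rsmul K M c ∘ₗ rsmul K M d :=
      LinearMap.ext fun m => mul_smul c d m
    change Fun.act K A M X (c * d) _ = Fun.act K A M X c (Fun.act K A M X d _)
    rw [Fun.act_proj, Fun.act_proj, Fun.act_proj, h, LinearMap.lTensor_comp,
      LinearMap.comp_apply]
  smul_zero c := map_zero (Fun.act K A M X c)
  smul_add c := map_add (Fun.act K A M X c)
  add_smul c d z := by
    obtain ⟨z, rfl⟩ := Fun.proj_surjective K A M X z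
    have h : rsmul K M (c + d) = rsmul K M c + rsmul K M d :=
      LinearMap.ext fun m => add_smul c d m
    change Fun.act K A M X (c + d) _ = Fun.act K A M X c _ + Fun.act K A M X d _
    rw [Fun.act_proj, Fun.act_proj, Fun.act_proj, h, LinearMap.lTensor_add,
      LinearMap.add_apply, map_add]
  zero_smul z := by
    obtain ⟨z, rfl⟩ := Fun.proj_surjective K A M X z
    have h : rsmul K M (0 : Aᵐᵒᵖ) = 0 := LinearMap.ext fun m => zero_smul _ m
    change Fun.act K A M X 0 _ = 0
    rw [Fun.act_proj, h, LinearMap.lTensor_zero, LinearMap.zero_apply, map_zero]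

instance : IsScalarTower K Aᵐᵒᵖ (Fun K A M X) where
  smul_assoc k c z := by
    obtain ⟨z, rfl⟩ := Fun.proj_surjective K A M X z
    have h : rsmul K M (k • c) = k • rsmul K M c :=
      LinearMap.ext fun m => smul_assoc k c m
    change Fun.act K A M X (k • c) _ = k • Fun.act K A M X c _
    rw [Fun.act_proj, Fun.act_proj, h, LinearMap.lTensor_smul, LinearMap.smul_apply, map_smul]

end Functor

section Simples

/-- `(L i)` is a complete set of pairwise non-isomorphic simple right `B`-modules. -/
structure IsCompleteSimples {B : Type*} [Ring B] {P : Type*} (L : P → Type*)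
    [∀ i, AddCommGroup (L i)] [∀ i, Module Bᵐᵒᵖ (L i)] : Prop where
  simple : ∀ i, IsSimpleModule Bᵐᵒᵖ (L i)
  eq_of_iso : ∀ i j, Nonempty (L i ≃ₗ[Bᵐᵒᵖ] L j) → i = j
  complete : ∀ I : Submodule Bᵐᵒᵖ B, IsSimpleModule Bᵐᵒᵖ (B ⧸ I) →
    ∃ i, Nonempty ((B ⧸ I) ≃ₗ[Bᵐᵒᵖ] L i)

/-- `π : Q → X` is a projective cover of `X`: `Q` is projective, `π` is surjective, and the kernel
of `π` is superfluous. -/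
def IsProjectiveCover {R : Type*} [Ring R] {Q X : Type*} [AddCommGroup Q] [Module R Q]
    [AddCommGroup X] [Module R X] (π : Q →ₗ[R] X) : Prop :=
  Module.Projective R Q ∧ Function.Surjective π ∧
    ∀ N : Submodule R Q, N ⊔ LinearMap.ker π = ⊤ → N = ⊤

/-- `Q` is isomorphic to a submodule of `X`. -/
def IsIsoToSubmodule (R : Type*) [Ring R] (Q X : Type*) [AddCommGroup Q] [Module R Q]
    [AddCommGroup X] [Module R X] : Prop :=
  ∃ f : Q →ₗ[R] X, Function.Injective f

/-- `Q` is isomorphic to a direct summand of `X`. -/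
def IsIsoToSummand (R : Type*) [Ring R] (Q X : Type*) [AddCommGroup Q] [Module R Q]
    [AddCommGroup X] [Module R X] : Prop :=
  ∃ (i : Q →ₗ[R] X) (p : X →ₗ[R] Q), p ∘ₗ i = LinearMap.id

/-- The set of indices `i` with `F(L i) ≠ 0`. -/
def nonzeroSet (K : Type*) [Field K] (A : Type*) [Ring A] [Algebra K A]
    (M : Type*) [AddCommGroup M] [Module K M] [Module Aᵐᵒᵖ M] [IsScalarTower K Aᵐᵒᵖ M]
    {P : Type*} (L : P → Type*) [∀ i, AddCommGroup (L i)] [∀ i, Module K (L i)]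
    [∀ i, Module (SchurAlg A M)ᵐᵒᵖ (L i)] : Set P :=
  {i | Nontrivial (Fun K A M (L i))}

end Simples

end SchurPair

/-! Write e = ι ∘ π. Since `A` is a summand of `M`, evaluation s ↦ s(ι 1) identifies S e with M as
left S-modules, with inverse `homOf π`. Hence F(X) = X ⊗_S M is X e, a module over e S e ≅ A.
Twisting by the star and using e^* = e, M_R is the right ideal e S; so it is projective, its
endomorphisms are the right action of A, and θ makes it self-dual.

Most conditions reduce to L e ≠ 0. This says F(L) ≠ 0 (`Fun.nontrivial_iff`). It also says Hom(M_R,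
L) ≠ 0, so that the projective cover P of L splits off M_R, and, by self-duality of M_R, Hom(L, M_R)
≠ 0 (`IsTranspose.isIsoToSubmodule_iff`). If P is injective, then it splits off a power of M_R,
because S embeds in such a power; so again Hom(M_R, L) ≠ 0. A self-dual projective is injective
(`RDual.injective_of_projective`).

The implication from summand to self-dual (`isSelfDual_of_isIsoToSummand`) is where symmetry of A
and self-duality of D = F(L) enter. Here P = M_R f with f in A, and P^* is the summand of M_R^* ≅
M_R cut out by f^*. By `IsSymmetricAlgebra.exists_adj_eq` the star of S on e S e ≅ A is that of A up
to conjugation by a unit w. As P covers L, D f^* ≠ 0; self-duality of D gives D f ≠ 0, which is a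
nonzero map P^* → L. Being projective, P^* then surjects onto P, and the dimensions agree. -/

namespace SchurPair

/-! ### Duality and injectivity. -/

section DualModules

variable {K : Type*} [Field K] {B : Type*} [Ring B] [Algebra K B] {σ : B →ₐ[K] Bᵐᵒᵖ}
  {X : Type*} [AddCommGroup X] [Module K X]

/-- A linear form as an element of the dual module. -/
def RDual.ofForm (σ : B →ₐ[K] Bᵐᵒᵖ) (f : X →ₗ[K] K) : RDual σ X := f

theorem RDual.ext {f g : RDual σ X} (h : ∀ x, f.form x = g.form x) : f = g :=
  LinearMap.ext h

theorem RDual.form_smul_apply (k : K) (f : RDual σ X) (x : X) :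
    (k • f).form x = k * f.form x := rfl

theorem RDual.finrank_eq : Module.finrank K (RDual σ X) = Module.finrank K X :=
  Subspace.dual_finrank_eq (K := K) (V := X)

instance [FiniteDimensional K X] : FiniteDimensional K (RDual σ X) :=
  inferInstanceAs (FiniteDimensional K (Module.Dual K X))

variable [Module Bᵐᵒᵖ X] [IsScalarTower K Bᵐᵒᵖ X]
  {Y : Type*} [AddCommGroup Y] [Module K Y] [Module Bᵐᵒᵖ Y] [IsScalarTower K Bᵐᵒᵖ Y]

theorem algebraMap_unop_star (σ : B →ₐ[K] Bᵐᵒᵖ) (k : K) :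
    σ (algebraMap K Bᵐᵒᵖ k).unop = algebraMap K Bᵐᵒᵖ k := by
  rw [MulOpposite.algebraMap_apply, MulOpposite.unop_op]
  exact σ.commutes k

instance : IsScalarTower K Bᵐᵒᵖ (RDual σ X) :=
  IsScalarTower.of_algebraMap_smul fun k f => RDual.ext fun x => by
    rw [RDual.smul_form_apply, algebraMap_unop_star, algebraMap_smul, map_smul,
      RDual.form_smul_apply, smul_eq_mul]

/-- The transpose `Y^* → X^*` of a homomorphism `X → Y`. -/
def RDual.map (σ : B →ₐ[K] Bᵐᵒᵖ) (f : X →ₗ[Bᵐᵒᵖ] Y) : RDual σ Y →ₗ[Bᵐᵒᵖ] RDual σ X where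
  toFun g := RDual.ofForm σ (g.form ∘ₗ f.restrictScalars K)
  map_add' _ _ := rfl
  map_smul' c g := RDual.ext fun x => by
    change g.form (σ c.unop • f x) = g.form (f (σ c.unop • x))
    rw [map_smul f]

theorem RDual.map_form_apply (f : X →ₗ[Bᵐᵒᵖ] Y) (g : RDual σ Y) (x : X) :
    (RDual.map σ f g).form x = g.form (f x) := rfl

/-- The inverse of a bijective anti-homomorphism. -/
noncomputable def invStar (σ : B →ₐ[K] Bᵐᵒᵖ) (hσ : Function.Bijective σ) : B →ₐ[K] Bᵐᵒᵖ :=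
  AlgHom.opComm.symm (AlgEquiv.ofBijective σ hσ).symm.toAlgHom

theorem star_unop_invStar (hσ : Function.Bijective σ) (b : B) :
    σ (invStar σ hσ b).unop = MulOpposite.op b :=
  (AlgEquiv.ofBijective σ hσ).apply_symm_apply (MulOpposite.op b)

theorem invStar_unop_star (hσ : Function.Bijective σ) (b : B) :
    invStar σ hσ (σ b).unop = MulOpposite.op b :=
  congrArg MulOpposite.op ((AlgEquiv.ofBijective σ hσ).symm_apply_apply b)

/-- The correspondence between homomorphisms `Y → X^*` and `X → Y^*` where the second dual is
formed with the inverse anti-automorphism. -/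
def RDual.flip {σ τ : B →ₐ[K] Bᵐᵒᵖ} (h : ∀ b, σ (τ b).unop = MulOpposite.op b)
    (g : Y →ₗ[Bᵐᵒᵖ] RDual σ X) : X →ₗ[Bᵐᵒᵖ] RDual τ Y where
  toFun x := RDual.ofForm τ
    { toFun := fun y => (g y).form x
      map_add' := fun y z => by rw [map_add]; rfl
      map_smul' := fun k y => by
        rw [← algebraMap_smul Bᵐᵒᵖ k y, map_smul, algebraMap_smul]; rfl }
  map_add' x x' := RDual.ext fun y => map_add (g y).form x x'
  map_smul' c x := RDual.ext fun y => by
    change (g y).form (c • x) = (g (τ c.unop • y)).form x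
    rw [map_smul g, RDual.smul_form_apply, h, MulOpposite.op_unop]

theorem RDual.map_surjective (f : X →ₗ[Bᵐᵒᵖ] Y) (hf : Function.Injective f) :
    Function.Surjective (RDual.map σ f) := by
  intro g
  obtain ⟨r, hr⟩ := (f.restrictScalars K).exists_leftInverse_of_injective
    (LinearMap.ker_eq_bot.2 hf)
  refine ⟨RDual.ofForm σ (g.form ∘ₗ r), RDual.ext fun x => ?_⟩
  exact congrArg g.form (LinearMap.congr_fun hr x)

/-- A module isomorphic to the dual of a projective module is injective. -/
theorem RDual.injective_of_projective (hσ : Function.Bijective σ) [Module.Projective Bᵐᵒᵖ X]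
    {Z : Type*} [AddCommGroup Z] [Module Bᵐᵒᵖ Z] (Φ : Z ≃ₗ[Bᵐᵒᵖ] RDual σ X) :
    Module.Injective Bᵐᵒᵖ Z := by
  refine Module.Baer.injective fun I g => ?_
  -- Under `RDual.flip`, extending `g` from `I` to the whole ring becomes lifting X → I^* along the
  -- surjection dual to the inclusion of `I`.
  obtain ⟨G, hG⟩ := Module.projective_lifting_property
    (RDual.map (invStar σ hσ) (Submodule.subtype I))
    (RDual.flip (star_unop_invStar hσ) ((Φ : Z →ₗ[Bᵐᵒᵖ] RDual σ X) ∘ₗ g))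
    (RDual.map_surjective _ I.subtype_injective)
  refine ⟨(Φ.symm : RDual σ X →ₗ[Bᵐᵒᵖ] Z) ∘ₗ RDual.flip (invStar_unop_star hσ) G,
    fun c hc => Φ.injective ?_⟩
  rw [LinearMap.comp_apply, LinearEquiv.coe_coe, LinearEquiv.apply_symm_apply]
  refine RDual.ext fun x => ?_
  exact congrArg (fun f => RDual.form f ⟨c, hc⟩) (LinearMap.congr_fun hG x)

end DualModules

/-! ### The `K`-structure on twisted modules. -/

section TwistedModules

variable {K : Type*} [Field K] {B : Type*} [Ring B] [Algebra K B] {σ : B →ₐ[K] Bᵐᵒᵖ}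
  {X : Type*} [AddCommGroup X]

instance [Module K X] : Module K (RTwist σ X) := inferInstanceAs (Module K X)

theorem RTwist.smul_def [Module B X] (c : Bᵐᵒᵖ) (x : RTwist σ X) :
    c • x = RTwist.mk σ ((σ c.unop).unop • x.val) := rfl

instance [Module K X] [Module B X] [IsScalarTower K B X] :
    IsScalarTower K Bᵐᵒᵖ (RTwist σ X) :=
  IsScalarTower.of_algebraMap_smul fun k x => by
    rw [RTwist.smul_def, algebraMap_unop_star]
    exact algebraMap_smul B k x.val

instance [Module K X] [FiniteDimensional K X] : FiniteDimensional K (RTwist σ X) :=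
  inferInstanceAs (FiniteDimensional K X)

end TwistedModules

/-! ### The transposed form and self-duality of M_R. -/

section Transpose

variable {K : Type*} [Field K] {A : Type*} [Ring A] [Algebra K A]
  {M : Type*} [AddCommGroup M] [Module K M] [Module Aᵐᵒᵖ M] [IsScalarTower K Aᵐᵒᵖ M]
  {σ : A →ₐ[K] Aᵐᵒᵖ}

/-- The bilinear forms on `M` given by `θ` and `θ'` are transposes of each other. -/
def IsTranspose (θ θ' : M ≃ₗ[Aᵐᵒᵖ] RDual σ M) : Prop :=
  ∀ x y : M, (θ' x).form y = (θ y).form x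

theorem IsTranspose.symm {θ θ' : M ≃ₗ[Aᵐᵒᵖ] RDual σ M} (h : IsTranspose θ θ') :
    IsTranspose θ' θ := fun x y => (h y x).symm

/-- The form of `θ` need not be symmetric, so the star of S need not be an involution. The
transposed form supplies its inverse, `adj θ'`. -/
theorem exists_isTranspose [FiniteDimensional K M] (hσ : IsAntiInvolution σ)
    (θ : M ≃ₗ[Aᵐᵒᵖ] RDual σ M) : ∃ θ' : M ≃ₗ[Aᵐᵒᵖ] RDual σ M, IsTranspose θ θ' := by
  have hf : ∀ b, σ (σ b).unop = MulOpposite.op b := fun b =>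
    MulOpposite.unop_injective (hσ b)
  let f : M →ₗ[Aᵐᵒᵖ] RDual σ M := RDual.flip hf (θ : M →ₗ[Aᵐᵒᵖ] RDual σ M)
  have hinj : Function.Injective (f.restrictScalars K) := by
    refine (injective_iff_map_eq_zero _).2 fun x hx => ?_
    refine (Module.forall_dual_apply_eq_zero_iff K x).1 fun φ => ?_
    have h := congrArg (fun g => RDual.form g (θ.symm (RDual.ofForm σ φ))) hx
    change (θ (θ.symm (RDual.ofForm σ φ))).form x = 0 at h
    rwa [θ.apply_symm_apply] at h
  have hsurj := (LinearMap.injective_iff_surjective_of_finrank_eq_finrank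
    (RDual.finrank_eq (K := K) (σ := σ) (X := M)).symm).1 hinj
  exact ⟨LinearEquiv.ofBijective f ⟨hinj, hsurj⟩, fun _ _ => rfl⟩

variable {θ θ' : M ≃ₗ[Aᵐᵒᵖ] RDual σ M}

theorem adj_mul (θ : M ≃ₗ[Aᵐᵒᵖ] RDual σ M) (s t : SchurAlg A M) :
    adj θ (s * t) = adj θ t * adj θ s :=
  congrArg MulOpposite.unop (map_mul (schurStar θ) s t)

theorem IsTranspose.adj_adj (h : IsTranspose θ θ') (s : SchurAlg A M) :
    adj θ (adj θ' s) = s :=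
  adj_unique θ _ _ fun m x => by rw [← h x (s m), ← h (adj θ' s x) m, form_adj]

theorem IsTranspose.bijective_schurStar (h : IsTranspose θ θ') :
    Function.Bijective (schurStar θ) :=
  Function.bijective_iff_has_inverse.2 ⟨fun s => adj θ' s.unop, h.symm.adj_adj,
    fun s => congrArg MulOpposite.op (h.adj_adj s.unop)⟩

theorem RTwist.op_smul (s : SchurAlg A M) (m : RTwist (schurStar θ) M) :
    MulOpposite.op s • m = RTwist.mk (schurStar θ) (adj θ s m.val) := rfl

/-- The right `S`-module `M_R` is self-dual. -/
noncomputable def IsTranspose.twistEquivDual (h : IsTranspose θ θ') :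
    RTwist (schurStar θ) M ≃ₗ[(SchurAlg A M)ᵐᵒᵖ] RDual (schurStar θ) (RTwist (schurStar θ) M) where
  -- `θ'` and not `θ`: S acts on the dual through s^{**}, whereas θ(s^* m)(x) = θ(m)(s x), which
  -- fits only when s^{**} = s.
  toFun m := RDual.ofForm (schurStar θ) (θ' m.val).form
  map_add' m n := by
    refine RDual.ext fun x => ?_
    change (θ' (m.val + n.val)).form x.val = _
    rw [map_add]
    rfl
  map_smul' c m := by
    refine RDual.ext fun x => ?_
    change (θ' (adj θ c.unop m.val)).form x.val =
      (θ' m.val).form (adj θ (adj θ c.unop) x.val)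
    rw [h, h, form_adj]
  invFun f := RTwist.mk (schurStar θ) (θ'.symm (RDual.ofForm σ f.form))
  left_inv m := θ'.symm_apply_apply m.val
  right_inv f := θ'.apply_symm_apply (RDual.ofForm σ f.form)

theorem IsTranspose.twistEquivDual_form (h : IsTranspose θ θ')
    (m x : RTwist (schurStar θ) M) :
    (h.twistEquivDual m).form x = (θ x.val).form m.val := h m.val x.val

end Transpose

/-! ### M as S e, and M_R as a cyclic projective module. -/

section Generator

variable {K : Type*} [Field K] {A : Type*} [Ring A] [Algebra K A]
  {M : Type*} [AddCommGroup M] [Module K M] [Module Aᵐᵒᵖ M] [IsScalarTower K Aᵐᵒᵖ M]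
  {σ : A →ₐ[K] Aᵐᵒᵖ} {θ θ' : M ≃ₗ[Aᵐᵒᵖ] RDual σ M}

/-- The endomorphism `x ↦ m · π(x)` of `M`. -/
def homOf (π : M →ₗ[Aᵐᵒᵖ] A) (m : M) : SchurAlg A M where
  toFun x := MulOpposite.op (π x) • m
  map_add' x y := by rw [map_add, MulOpposite.op_add, add_smul]
  map_smul' c x := by
    rw [map_smul, ← MulOpposite.op_unop c, op_smul_eq_mul, MulOpposite.op_mul, mul_smul]
    rfl

variable {π : M →ₗ[Aᵐᵒᵖ] A} {ι : A →ₗ[Aᵐᵒᵖ] M}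

theorem homOf_apply (m x : M) : homOf π m x = MulOpposite.op (π x) • m := rfl

theorem homOf_add (m n : M) : homOf π (m + n) = homOf π m + homOf π n :=
  LinearMap.ext fun _ => smul_add _ m n

theorem homOf_smul (k : K) (m : M) : homOf π (k • m) = k • homOf π m :=
  LinearMap.ext fun _ => smul_comm _ k m

theorem mul_homOf (s : SchurAlg A M) (m : M) : s * homOf π m = homOf π (s m) :=
  LinearMap.ext fun _ => map_smul s _ m

theorem op_smul_incl (a b : A) : MulOpposite.op b • ι a = ι (a * b) := by
  rw [← map_smul, op_smul_eq_mul]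

theorem homOf_incl_apply (a : A) (x : M) : homOf π (ι a) x = ι (a * π x) := by
  rw [homOf_apply, op_smul_incl]

theorem homOf_incl_one : homOf π (ι 1) = ι ∘ₗ π :=
  LinearMap.ext fun x => by rw [homOf_incl_apply, one_mul]; rfl

theorem proj_incl (hπι : π ∘ₗ ι = LinearMap.id) (a : A) : π (ι a) = a :=
  LinearMap.congr_fun hπι a

theorem homOf_apply_incl (hπι : π ∘ₗ ι = LinearMap.id) (m : M) (a : A) :
    homOf π m (ι a) = MulOpposite.op a • m := by
  rw [homOf_apply, proj_incl hπι]

theorem homOf_apply_incl_one (hπι : π ∘ₗ ι = LinearMap.id) (m : M) :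
    homOf π m (ι 1) = m := by
  rw [homOf_apply_incl hπι, MulOpposite.op_one, one_smul]

variable {X : Type*} [AddCommGroup X] [Module (SchurAlg A M)ᵐᵒᵖ X]

/-- The homomorphism `M_R → X` with `m ↦ x · s` where `s^* = (y ↦ m · π(y))`. -/
def IsTranspose.twistHom (h : IsTranspose θ θ') (π : M →ₗ[Aᵐᵒᵖ] A) (x : X) :
    RTwist (schurStar θ) M →ₗ[(SchurAlg A M)ᵐᵒᵖ] X where
  toFun m := MulOpposite.op (adj θ' (homOf π m.val)) • x
  map_add' m n := by
    change (schurStar θ' (homOf π (m.val + n.val))) • x = _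
    rw [homOf_add, map_add, add_smul]
    rfl
  map_smul' c m := by
    change MulOpposite.op (adj θ' (homOf π (adj θ c.unop m.val))) • x = _
    rw [← mul_homOf, adj_mul, h.symm.adj_adj, MulOpposite.op_mul, mul_smul]
    rfl

theorem IsTranspose.twistHom_apply (h : IsTranspose θ θ') (x : X)
    (m : RTwist (schurStar θ) M) :
    h.twistHom π x m = MulOpposite.op (adj θ' (homOf π m.val)) • x := rfl

theorem IsTranspose.eq_smul_incl_one (h : IsTranspose θ θ') (hπι : π ∘ₗ ι = LinearMap.id)
    (m : RTwist (schurStar θ) M) :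
    MulOpposite.op (adj θ' (homOf π m.val)) • RTwist.mk (schurStar θ) (ι 1) = m := by
  change adj θ (adj θ' (homOf π m.val)) (ι 1) = m.val
  rw [h.adj_adj, homOf_apply_incl_one hπι]

/-- `M_R` is generated by `1 ∈ A ⊆ M`. -/
theorem IsTranspose.map_twist (h : IsTranspose θ θ') (hπι : π ∘ₗ ι = LinearMap.id)
    (g : RTwist (schurStar θ) M →ₗ[(SchurAlg A M)ᵐᵒᵖ] X) (m : RTwist (schurStar θ) M) :
    g m = MulOpposite.op (adj θ' (homOf π m.val)) • g (RTwist.mk (schurStar θ) (ι 1)) := by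
  rw [← map_smul, h.eq_smul_incl_one hπι]

/-- The surjection S → M_R given by the generator `ι 1` is split by sending m to the inverse star of
`homOf π m`. -/
theorem IsTranspose.projective_twist (h : IsTranspose θ θ') (hπι : π ∘ₗ ι = LinearMap.id) :
    Module.Projective (SchurAlg A M)ᵐᵒᵖ (RTwist (schurStar θ) M) := by
  refine Module.Projective.of_split (h.twistHom π (1 : (SchurAlg A M)ᵐᵒᵖ))
    (LinearMap.toSpanSingleton _ _ (RTwist.mk (schurStar θ) (ι 1))) (LinearMap.ext fun m => ?_)
  rw [LinearMap.comp_apply, LinearMap.toSpanSingleton_apply, h.twistHom_apply, smul_eq_mul,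
    mul_one, h.eq_smul_incl_one hπι]
  rfl

/-- If `e^* = e` and `X e = 0` then every homomorphism `M_R → X` vanishes. -/
theorem eq_zero_of_smul_idempotent_eq_zero (h : IsTranspose θ θ')
    (hπι : π ∘ₗ ι = LinearMap.id) (he : adj θ (ι ∘ₗ π) = ι ∘ₗ π)
    (hX : ∀ x : X, MulOpposite.op (homOf π (ι 1)) • x = 0)
    (g : RTwist (schurStar θ) M →ₗ[(SchurAlg A M)ᵐᵒᵖ] X) : g = 0 := by
  refine LinearMap.ext fun m => ?_
  -- `ι 1` is fixed by e = e^*, so its image under `g` lies in X e.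
  have h1 : MulOpposite.op (homOf π (ι 1)) • RTwist.mk (schurStar θ) (ι 1) =
      RTwist.mk (schurStar θ) (ι 1) := by
    change adj θ (homOf π (ι 1)) (ι 1) = ι 1
    rw [homOf_incl_one, he, ← homOf_incl_one, homOf_apply_incl_one hπι]
  rw [h.map_twist hπι, ← h1, map_smul, hX, smul_zero, LinearMap.zero_apply]

end Generator

/-! ### The functor F as X ↦ X e. -/

section Evaluation

variable {K : Type*} [Field K] {A : Type*} [Ring A] [Algebra K A]
  {M : Type*} [AddCommGroup M] [Module K M] [Module Aᵐᵒᵖ M] [IsScalarTower K Aᵐᵒᵖ M]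
  {π : M →ₗ[Aᵐᵒᵖ] A} {ι : A →ₗ[Aᵐᵒᵖ] M}
  (X : Type*) [AddCommGroup X] [Module K X] [Module (SchurAlg A M)ᵐᵒᵖ X]

theorem Fun.op_smul_proj_tmul (c : Aᵐᵒᵖ) (x : X) (m : M) :
    c • Fun.proj K A M X (x ⊗ₜ[K] m) = Fun.proj K A M X (x ⊗ₜ[K] (c • m)) := rfl

theorem Fun.proj_smul_tmul (s : SchurAlg A M) (x : X) (m : M) :
    Fun.proj K A M X ((MulOpposite.op s • x) ⊗ₜ[K] m) = Fun.proj K A M X (x ⊗ₜ[K] s m) :=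
  (Submodule.Quotient.eq _).2 (Submodule.subset_span ⟨x, s, m, rfl⟩)

variable [IsScalarTower K (SchurAlg A M)ᵐᵒᵖ X]

/-- The map `X ⊗_S M → X` sending `x ⊗ m` to `x · (y ↦ m · π(y))`. -/
def Fun.eval (π : M →ₗ[Aᵐᵒᵖ] A) : Fun K A M X →ₗ[K] X :=
  Submodule.liftQ (balancedRel K (B := SchurAlg A M) X M)
    (TensorProduct.lift (LinearMap.mk₂ K (fun x m => MulOpposite.op (homOf π m) • x)
      (fun x y m => smul_add _ x y) (fun k x m => smul_comm _ k x)
      (fun x m n => by rw [homOf_add, MulOpposite.op_add, add_smul])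
      (fun k x m => by rw [homOf_smul, MulOpposite.op_smul, smul_assoc]))) <| by
    refine Submodule.span_le.2 ?_
    rintro _ ⟨x, s, m, rfl⟩
    rw [SetLike.mem_coe, LinearMap.mem_ker, map_sub, TensorProduct.lift.tmul,
      TensorProduct.lift.tmul, LinearMap.mk₂_apply, LinearMap.mk₂_apply, Module.End.smul_def,
      ← mul_homOf, MulOpposite.op_mul, mul_smul, sub_self]

theorem Fun.eval_proj_tmul (x : X) (m : M) :
    Fun.eval X π (Fun.proj K A M X (x ⊗ₜ[K] m)) = MulOpposite.op (homOf π m) • x := rfl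

/-- Under `F(X) ≅ X e`, the action of `c ∈ A` is the action of the corresponding element of
`e S e`. -/
theorem Fun.smul_eq_zero_iff (hπι : π ∘ₗ ι = LinearMap.id) (c : A) :
    (∀ z : Fun K A M X, MulOpposite.op c • z = 0) ↔
      ∀ x : X, MulOpposite.op (homOf π (ι c)) • x = 0 := by
  constructor
  · intro h x
    have h1 := congrArg (Fun.eval X π) (h (Fun.proj K A M X (x ⊗ₜ[K] ι 1)))
    rwa [Fun.op_smul_proj_tmul, op_smul_incl, one_mul, Fun.eval_proj_tmul, map_zero] at h1
  · intro h z
    obtain ⟨z, rfl⟩ := Fun.proj_surjective K A M X z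
    induction z with
    | zero => rw [map_zero, smul_zero]
    | add y z hy hz => rw [map_add, smul_add, hy, hz, add_zero]
    | tmul x m =>
      -- Here m c = `homOf π m` (ι c) and ι c = `homOf π (ι c)` (ι 1); both endomorphisms cross the
      -- tensor sign to act on x.
      rw [Fun.op_smul_proj_tmul, ← homOf_apply_incl hπι, ← Fun.proj_smul_tmul,
        ← homOf_apply_incl_one hπι (ι c), ← Fun.proj_smul_tmul, h, TensorProduct.zero_tmul,
        map_zero]

/-- The case c = 1 of the preceding equivalence, `homOf π (ι 1)` being e. -/
theorem Fun.nontrivial_iff (hπι : π ∘ₗ ι = LinearMap.id) :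
    Nontrivial (Fun K A M X) ↔ ∃ x : X, MulOpposite.op (homOf π (ι 1)) • x ≠ 0 := by
  have h := not_congr (Fun.smul_eq_zero_iff X hπι (K := K) 1)
  push Not at h
  rw [← h, nontrivial_iff_exists_ne (0 : Fun K A M X)]
  simp

end Evaluation

/-! ### The star of S on e S e for symmetric A. -/

section Symmetric

variable {K : Type*} [Field K] {A : Type*} [Ring A] [Algebra K A]
  {M : Type*} [AddCommGroup M] [Module K M] [Module Aᵐᵒᵖ M] [IsScalarTower K Aᵐᵒᵖ M]
  {σ : A →ₐ[K] Aᵐᵒᵖ} {θ θ' : M ≃ₗ[Aᵐᵒᵖ] RDual σ M}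
  {π : M →ₗ[Aᵐᵒᵖ] A} {ι : A →ₗ[Aᵐᵒᵖ] M}

/-- If `A` is symmetric then the restriction of the anti-automorphism of `S` to `e S e ≅ A` is the
anti-involution of `A` up to an inner automorphism. -/
theorem IsSymmetricAlgebra.exists_adj_eq [FiniteDimensional K A] (hsym : IsSymmetricAlgebra K A)
    (hπι : π ∘ₗ ι = LinearMap.id) (he : adj θ (ι ∘ₗ π) = ι ∘ₗ π) :
    ∃ w : Aˣ, ∀ c : A,
      adj θ (homOf π (ι (↑w⁻¹ * (σ c).unop * ↑w))) = homOf π (ι c) := by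
  obtain ⟨β, hnd, hsymm, hassoc⟩ := hsym
  -- The form of `M` restricted to `A` is (a, y) ↦ ψ(y a^*), and `w` represents ψ with respect to β.
  let ψ : A →ₗ[K] K := (θ (ι 1)).form ∘ₗ ι.restrictScalars K
  obtain ⟨w, hw⟩ := (β.toDual hnd).surjective ψ
  have hwψ : ∀ a, β w a = ψ a := fun a => LinearMap.congr_fun hw a
  have hcyc : ∀ a x y : A, β a (x * y) = β (y * a) x := fun a x y => by
    rw [hsymm.eq a, hassoc, hsymm.eq x]
  have hform : ∀ a y : A, (θ (ι a)).form (ι y) = β w (y * (σ a).unop) := fun a y => by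
    rw [hwψ]
    change _ = (θ (ι 1)).form (ι (y * (σ a).unop))
    rw [← op_smul_incl, MulOpposite.op_unop]
    have h1 := RDual.smul_form_apply (MulOpposite.op a) (θ (ι 1)) (ι y)
    rw [← map_smul, op_smul_incl, one_mul] at h1
    exact h1
  have hproj : ∀ m x : M, (θ (ι (π m))).form x = (θ m).form (ι (π x)) := fun m x => by
    have h1 := form_adj θ (ι ∘ₗ π) m x
    rwa [he] at h1
  -- If w y = 0 then ι y is orthogonal to ι A, hence to all of `M` because e^* = e. Finite dimension
  -- then makes `w` a unit.
  have hinj : Function.Injective (LinearMap.mulLeft K w) := by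
    refine (injective_iff_map_eq_zero _).2 fun y hy => ?_
    have h0 : ∀ m : M, (θ m).form (ι y) = 0 := fun m => by
      have h1 := hproj m (ι y)
      rw [proj_incl hπι] at h1
      rw [← h1, hform, ← hassoc]
      change β (LinearMap.mulLeft K w y) _ = 0
      rw [hy, map_zero, LinearMap.zero_apply]
    have h2 : ι y = 0 := (Module.forall_dual_apply_eq_zero_iff K (ι y)).1 fun φ => by
      have h3 := h0 (θ.symm (RDual.ofForm σ φ))
      rwa [θ.apply_symm_apply] at h3
    rw [← proj_incl hπι y, h2, map_zero]
  obtain ⟨v, hv⟩ := LinearMap.injective_iff_surjective.1 hinj 1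
  have hv' : w * v = 1 := hv
  refine ⟨⟨w, v, hv', ?_⟩, fun c => adj_unique θ _ _ fun m x => ?_⟩
  · refine hinj ?_
    change w * (v * w) = w * 1
    rw [← mul_assoc, hv', one_mul, mul_one]
  · change _ = (θ m).form (homOf π (ι (v * (σ c).unop * w)) x)
    have h1 := hproj (ι (c * π m)) x
    have h2 := hproj m (ι (v * (σ c).unop * w * π x))
    rw [proj_incl hπι] at h1 h2
    -- Both sides equal β(c^* w, π x (π m)^*): one by the cyclic property of β, the other by w v =
    -- 1.
    rw [homOf_incl_apply, homOf_incl_apply, h1, ← h2, hform, hform, map_mul σ,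
      MulOpposite.unop_mul, ← mul_assoc, hcyc, mul_assoc _ (π x), ← hassoc _ w, ← mul_assoc w,
      ← mul_assoc w, hv', one_mul]

end Symmetric

/-! ### Projective covers of simple modules. -/

section Covers

variable {R : Type*} [Ring R] {Q : Type*} [AddCommGroup Q] [Module R Q]
  {X : Type*} [AddCommGroup X] [Module R X] {Y : Type*} [AddCommGroup Y] [Module R Y]

/-- A nonzero homomorphism from a projective module to a simple module lifts to an epimorphism
onto the projective cover. -/
theorem IsProjectiveCover.exists_surjective {q : Q →ₗ[R] X} (hq : IsProjectiveCover q)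
    [IsSimpleModule R X] [Module.Projective R Y] (g : Y →ₗ[R] X) (hg : g ≠ 0) :
    ∃ f : Y →ₗ[R] Q, Function.Surjective f := by
  obtain ⟨f, hf⟩ := Module.projective_lifting_property q g hq.2.1
  refine ⟨f, LinearMap.range_eq_top.1 (hq.2.2 _ (eq_top_iff.2 fun x _ => ?_))⟩
  obtain ⟨y, hy⟩ := (LinearMap.surjective_or_eq_zero g).resolve_right hg (q x)
  refine Submodule.mem_sup.2 ⟨f y, LinearMap.mem_range_self f y, x - f y, ?_, by abel⟩
  rw [LinearMap.mem_ker, map_sub, ← hy, ← hf, LinearMap.comp_apply, sub_self]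

/-- A projective cover of a simple `R`-module is a direct summand of `R`. -/
theorem IsProjectiveCover.isIsoToSummand {q : Q →ₗ[R] X} (hq : IsProjectiveCover q)
    [IsSimpleModule R X] : IsIsoToSummand R Q R := by
  obtain ⟨x, hx⟩ := @exists_ne X (IsSimpleModule.nontrivial R X) 0
  obtain ⟨p, hp⟩ := hq.exists_surjective (LinearMap.toSpanSingleton R X x) fun h => hx <| by
    rw [← one_smul R x, ← LinearMap.toSpanSingleton_apply, h, LinearMap.zero_apply]
  have := hq.1
  obtain ⟨i, hi⟩ := Module.projective_lifting_property p LinearMap.id hp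
  exact ⟨i, p, hi⟩

end Covers

/-! ### Embeddings into M_R and its powers. -/

section Schur

variable {K : Type u} [Field K] {A : Type v} [Ring A] [Algebra K A]
  {M : Type w} [AddCommGroup M] [Module K M] [Module Aᵐᵒᵖ M] [IsScalarTower K Aᵐᵒᵖ M]
  {σ : A →ₐ[K] Aᵐᵒᵖ} {θ θ' : M ≃ₗ[Aᵐᵒᵖ] RDual σ M}
  {π : M →ₗ[Aᵐᵒᵖ] A} {ι : A →ₗ[Aᵐᵒᵖ] M}

/-- `S` embeds in a finite direct power of `M_R`. -/
theorem IsTranspose.exists_injective_pi [FiniteDimensional K M] (h : IsTranspose θ θ') :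
    ∃ f : (SchurAlg A M)ᵐᵒᵖ →ₗ[(SchurAlg A M)ᵐᵒᵖ]
      (Fin (Module.finrank K M) → RTwist (schurStar θ) M), Function.Injective f := by
  -- S acts faithfully on `M`, so s^* is determined by its values on a basis.
  let b := Module.finBasis K M
  refine ⟨LinearMap.pi fun j => LinearMap.toSpanSingleton _ _ (RTwist.mk (schurStar θ) (b j)),
    (injective_iff_map_eq_zero _).2 fun c hc => ?_⟩
  have h1 : adj θ c.unop = 0 := by
    refine LinearMap.ext fun m => ?_
    have h2 : (adj θ c.unop).restrictScalars K = 0 := b.ext fun j => congrFun hc j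
    exact LinearMap.congr_fun h2 m
  refine h.bijective_schurStar.1.eq_iff.1 ?_ |> MulOpposite.unop_injective
  change MulOpposite.op (adj θ c.unop) = _
  rw [h1, MulOpposite.unop_zero, map_zero, MulOpposite.op_zero]

variable {X : Type w} [AddCommGroup X] [Module (SchurAlg A M)ᵐᵒᵖ X]
  {Q : Type w} [AddCommGroup Q] [Module (SchurAlg A M)ᵐᵒᵖ Q]

/-- As a summand of S, `Q` embeds in a power of M_R, and injectivity splits the embedding. The
retraction followed by `q` is nonzero, hence nonzero on some factor. -/
theorem IsTranspose.exists_hom_ne_zero_of_injective [FiniteDimensional K M]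
    (h : IsTranspose θ θ') [IsSimpleModule (SchurAlg A M)ᵐᵒᵖ X]
    {q : Q →ₗ[(SchurAlg A M)ᵐᵒᵖ] X} (hq : IsProjectiveCover q)
    (hQ : Module.Injective (SchurAlg A M)ᵐᵒᵖ Q) :
    ∃ g : RTwist (schurStar θ) M →ₗ[(SchurAlg A M)ᵐᵒᵖ] X, g ≠ 0 := by
  obtain ⟨i, p, hpi⟩ := hq.isIsoToSummand
  obtain ⟨f, hf⟩ := h.exists_injective_pi
  have hi : Function.Injective i := fun x y hxy => by
    rw [← LinearMap.id_apply (R := (SchurAlg A M)ᵐᵒᵖ) x, ← hpi, LinearMap.comp_apply, hxy,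
      ← LinearMap.comp_apply, hpi, LinearMap.id_apply]
  obtain ⟨r, hr⟩ := hQ.out (f ∘ₗ i) (hf.comp hi) LinearMap.id
  by_contra! hz
  have h0 : q ∘ₗ r = 0 := LinearMap.pi_ext' fun j => hz _
  obtain ⟨x, hx⟩ := @exists_ne X (IsSimpleModule.nontrivial (SchurAlg A M)ᵐᵒᵖ X) 0
  obtain ⟨y, rfl⟩ := hq.2.1 x
  have h1 := LinearMap.congr_fun h0 ((f ∘ₗ i) y)
  rw [LinearMap.comp_apply, hr] at h1
  exact hx h1

variable [Module K X] [IsScalarTower K (SchurAlg A M)ᵐᵒᵖ X]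

/-- A simple module embeds in `M_R` if and only if it is not annihilated by `e`. -/
theorem IsTranspose.isIsoToSubmodule_iff
    (h : IsTranspose θ θ') (hπι : π ∘ₗ ι = LinearMap.id)
    (he : adj θ (ι ∘ₗ π) = ι ∘ₗ π) [IsSimpleModule (SchurAlg A M)ᵐᵒᵖ X] :
    IsIsoToSubmodule (SchurAlg A M)ᵐᵒᵖ X (RTwist (schurStar θ) M) ↔
      ∃ x : X, MulOpposite.op (homOf π (ι 1)) • x ≠ 0 := by
  have he' : adj θ (homOf π (ι 1)) = homOf π (ι 1) := by rw [homOf_incl_one, he]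
  have he'' : adj θ' (homOf π (ι 1)) = homOf π (ι 1) := by
    conv_lhs => rw [← he', h.symm.adj_adj]
  constructor
  · rintro ⟨f, hf⟩
    by_contra! hz
    obtain ⟨x, hx⟩ := @exists_ne X (IsSimpleModule.nontrivial (SchurAlg A M)ᵐᵒᵖ X) 0
    -- Since ι 1 = e(ι 1) and e^* = e, pairing with ι 1 sees only f(y) e = f(y e) = 0.
    have h0 : ∀ y, (θ (ι 1)).form (f y).val = 0 := fun y => by
      have h1 := form_adj θ (homOf π (ι 1)) (ι 1) (f y).val
      rw [he', homOf_apply_incl_one hπι] at h1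
      rw [h1, ← he']
      change (θ (ι 1)).form (MulOpposite.op (homOf π (ι 1)) • f y).val = 0
      rw [← map_smul, hz, map_zero]
      exact map_zero _
    refine hx (hf ?_)
    rw [map_zero]
    refine (Module.forall_dual_apply_eq_zero_iff K (f x).val).1 fun φ => ?_
    obtain ⟨m, hm⟩ := θ.surjective (RDual.ofForm σ φ)
    change (RDual.ofForm σ φ).form (f x).val = 0
    -- Every m is s(ι 1) for some s in S, and moving s across the form replaces x by another vector
    -- of `X`.
    rw [← hm, ← homOf_apply_incl_one hπι m, ← h.adj_adj (homOf π m), form_adj,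
      ← h.adj_adj (adj θ' (homOf π m))]
    change (θ (ι 1)).form (MulOpposite.op (adj θ' (adj θ' (homOf π m))) • f x).val = 0
    rw [← map_smul, h0]
  · rintro ⟨x, hx⟩
    obtain ⟨φ, hφ⟩ : ∃ φ : Module.Dual K X, φ (MulOpposite.op (homOf π (ι 1)) • x) ≠ 0 := by
      by_contra! hz
      exact hx ((Module.forall_dual_apply_eq_zero_iff K _).1 hz)
    have hadj : ∀ s t : SchurAlg A M, adj θ' (s + t) = adj θ' s + adj θ' t := fun s t =>
      congrArg MulOpposite.unop (map_add (schurStar θ') s t)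
    have hadj' : ∀ (k : K) (s : SchurAlg A M), adj θ' (k • s) = k • adj θ' s := fun k s =>
      congrArg MulOpposite.unop (map_smul (schurStar θ') k s)
    -- A functional on X e gives a map into M_R^*. The double `adj θ'` undoes the s^{**} through
    -- which S acts on M_R^*.
    let F : X →ₗ[(SchurAlg A M)ᵐᵒᵖ] RDual (schurStar θ) (RTwist (schurStar θ) M) :=
      { toFun := fun y => RDual.ofForm (schurStar θ)
          { toFun := fun m => φ (MulOpposite.op (adj θ' (adj θ' (homOf π m.val))) • y)
            map_add' := fun m n => by
              change φ (MulOpposite.op (adj θ' (adj θ' (homOf π (m.val + n.val)))) • y) = _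
              rw [homOf_add, hadj, hadj, MulOpposite.op_add, add_smul, map_add]
            map_smul' := fun k m => by
              change φ (MulOpposite.op (adj θ' (adj θ' (homOf π (k • m.val)))) • y) = _
              rw [homOf_smul, hadj', hadj', MulOpposite.op_smul, smul_assoc, map_smul]
              rfl }
        map_add' := fun y z => RDual.ext fun m => by
          change φ (_ • (y + z)) = φ (_ • y) + φ (_ • z)
          rw [smul_add, map_add]
        map_smul' := fun c y => RDual.ext fun m => by
          change φ (MulOpposite.op (adj θ' (adj θ' (homOf π m.val))) • c • y) =
            φ (MulOpposite.op (adj θ' (adj θ' (homOf π (adj θ (adj θ c.unop) m.val)))) • y)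
          rw [← mul_homOf, adj_mul, adj_mul, h.symm.adj_adj, h.symm.adj_adj,
            MulOpposite.op_mul, mul_smul, MulOpposite.op_unop] }
    let G := (h.twistEquivDual.symm : _ →ₗ[(SchurAlg A M)ᵐᵒᵖ] RTwist (schurStar θ) M) ∘ₗ F
    refine ⟨G, (LinearMap.injective_or_eq_zero G).resolve_right fun hG => hφ ?_⟩
    have hF : F x = 0 := h.twistEquivDual.symm.map_eq_zero_iff.1 (LinearMap.congr_fun hG x)
    have h1 : (F x).form (RTwist.mk (schurStar θ) (ι 1)) = 0 := by rw [hF]; rfl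
    change φ (MulOpposite.op (adj θ' (adj θ' (homOf π (ι 1)))) • x) = 0 at h1
    rwa [he'', he''] at h1

end Schur

/-! ### Self-duality of the summands of M_R. -/

section SelfDual

variable {K : Type u} [Field K] {A : Type v} [Ring A] [Algebra K A]
  {M : Type w} [AddCommGroup M] [Module K M] [Module Aᵐᵒᵖ M] [IsScalarTower K Aᵐᵒᵖ M]
  {σ : A →ₐ[K] Aᵐᵒᵖ} {θ θ' : M ≃ₗ[Aᵐᵒᵖ] RDual σ M}
  {π : M →ₗ[Aᵐᵒᵖ] A} {ι : A →ₗ[Aᵐᵒᵖ] M}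

/-- If `X` is self-dual and `X a^* ≠ 0` then `X a ≠ 0`. -/
theorem IsSelfDual.exists_smul_ne_zero {X : Type*} [AddCommGroup X] [Module K X] [Module Aᵐᵒᵖ X]
    [IsScalarTower K Aᵐᵒᵖ X] (hX : IsSelfDual σ X) {a : A} (ha : ∃ x : X, σ a • x ≠ 0) :
    ∃ x : X, MulOpposite.op a • x ≠ 0 := by
  obtain ⟨Φ⟩ := hX
  obtain ⟨x, hx⟩ := ha
  by_contra! hz
  refine hx ((Module.forall_dual_apply_eq_zero_iff K _).1 fun φ => ?_)
  have h := hz (Φ.symm (RDual.ofForm σ φ))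
  rw [← map_smul, Φ.symm.map_eq_zero_iff] at h
  exact congrArg (fun f => RDual.form f x) h

/-- Endomorphisms of `M_R` are given by the right action of elements of `A`. -/
theorem IsTranspose.end_twist_apply (h : IsTranspose θ θ') (hπι : π ∘ₗ ι = LinearMap.id)
    (f : Module.End (SchurAlg A M)ᵐᵒᵖ (RTwist (schurStar θ) M)) (m : RTwist (schurStar θ) M) :
    (f m).val = MulOpposite.op (π (f (RTwist.mk (schurStar θ) (ι 1))).val) • m.val := by
  rw [h.map_twist hπι f m, RTwist.op_smul]
  change adj θ (adj θ' (homOf π m.val)) _ = _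
  rw [h.adj_adj, homOf_apply]

variable {X : Type w} [AddCommGroup X] [Module K X] [Module (SchurAlg A M)ᵐᵒᵖ X]
  [IsScalarTower K (SchurAlg A M)ᵐᵒᵖ X]
  {Q : Type w} [AddCommGroup Q] [Module K Q] [Module (SchurAlg A M)ᵐᵒᵖ Q]
  [IsScalarTower K (SchurAlg A M)ᵐᵒᵖ Q]

/-- A projective cover of a simple module `X` that is a direct summand of `M_R` is self-dual, if
`F(X)` is self-dual. -/
theorem isSelfDual_of_isIsoToSummand [FiniteDimensional K M] [FiniteDimensional K A]
    (hsym : IsSymmetricAlgebra K A) (hσ : IsAntiInvolution σ) (h : IsTranspose θ θ')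
    (hπι : π ∘ₗ ι = LinearMap.id) (he : adj θ (ι ∘ₗ π) = ι ∘ₗ π)
    [IsSimpleModule (SchurAlg A M)ᵐᵒᵖ X] {q : Q →ₗ[(SchurAlg A M)ᵐᵒᵖ] X}
    (hq : IsProjectiveCover q) (hX : IsSelfDual σ (Fun K A M X))
    (hQ : IsIsoToSummand (SchurAlg A M)ᵐᵒᵖ Q (RTwist (schurStar θ) M)) :
    IsSelfDual (schurStar θ) Q := by
  obtain ⟨i, p, hpi⟩ := hQ
  obtain ⟨w, hw⟩ := hsym.exists_adj_eq hπι he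
  let f := π (i (p (RTwist.mk (schurStar θ) (ι 1)))).val
  have hf : ∀ m : RTwist (schurStar θ) M, (i (p m)).val = MulOpposite.op f • m.val :=
    h.end_twist_apply hπι (i ∘ₗ p)
  have hpi' : ∀ y, p (i y) = y := LinearMap.congr_fun hpi
  -- `F(X) w⁻¹ f^* w ≠ 0`
  have hne : ∃ x : X,
      MulOpposite.op (homOf π (ι (↑w⁻¹ * (σ f).unop * ↑w))) • x ≠ 0 := by
    by_contra! hz
    obtain ⟨x, hx⟩ := @exists_ne X (IsSimpleModule.nontrivial (SchurAlg A M)ᵐᵒᵖ X) 0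
    obtain ⟨y, rfl⟩ := hq.2.1 x
    refine hx ?_
    -- By the choice of `w`, the inner element sends ι 1 to ι f = i(p(ι 1)), from which all of i(Q)
    -- is generated. If it killed `X`, then q(y) = q(p(i y)) would vanish.
    have h1 : i y = MulOpposite.op (adj θ' (homOf π (i y).val)) •
        MulOpposite.op (homOf π (ι (↑w⁻¹ * (σ f).unop * ↑w))) •
          RTwist.mk (schurStar θ) (ι 1) := by
      change (i y).val = adj θ (adj θ' (homOf π (i y).val)) (adj θ _ (ι 1))
      rw [h.adj_adj, MulOpposite.unop_op, hw, homOf_apply_incl_one hπι, homOf_apply_incl hπι, ← hf, hpi']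
    rw [← hpi' y, h1, map_smul, map_smul, map_smul, map_smul, hz, smul_zero]
  have hconj : ∀ c : A, (∃ z : Fun K A M X, MulOpposite.op c • z ≠ 0) →
      ∃ z : Fun K A M X, MulOpposite.op (↑w⁻¹ * c * ↑w) • z ≠ 0 := by
    rintro c ⟨z, hz⟩
    by_contra! h0
    refine hz ?_
    have h1 := congrArg (MulOpposite.op (↑w⁻¹ : A) • ·) (h0 (MulOpposite.op (w : A) • z))
    simpa [← mul_smul, ← MulOpposite.op_mul, mul_assoc] using h1
  have hconj' : ∀ c : A, (∃ z : Fun K A M X, MulOpposite.op (↑w⁻¹ * c * ↑w) • z ≠ 0) →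
      ∃ z : Fun K A M X, MulOpposite.op c • z ≠ 0 := by
    rintro c ⟨z, hz⟩
    by_contra! h0
    refine hz ?_
    rw [MulOpposite.op_mul, MulOpposite.op_mul, mul_smul, mul_smul, h0, smul_zero]
  have hF : ∀ c : A, (∃ z : Fun K A M X, MulOpposite.op c • z ≠ 0) ↔
      ∃ x : X, MulOpposite.op (homOf π (ι c)) • x ≠ 0 := fun c => by
    have h1 := not_congr (Fun.smul_eq_zero_iff X hπι (K := K) c)
    push Not at h1
    exact h1
  -- Conjugate `w` away, exchange f^* for f by self-duality of F(X), and conjugate back.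
  obtain ⟨x, hx⟩ := (hF _).1 (hconj _ (hX.exists_smul_ne_zero (hconj' _ ((hF _).2 hne))))
  have hwf := hw (σ f).unop
  rw [hσ] at hwf
  let g : RTwist (schurStar θ) M →ₗ[(SchurAlg A M)ᵐᵒᵖ] X := h.twistHom π x
  let G : RDual (schurStar θ) Q →ₗ[(SchurAlg A M)ᵐᵒᵖ] X :=
    (g ∘ₗ (h.twistEquivDual.symm : _ →ₗ[(SchurAlg A M)ᵐᵒᵖ] RTwist (schurStar θ) M)) ∘ₗ
      RDual.map (schurStar θ) p
  have hG : G ≠ 0 := fun hG => by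
    let m : RTwist (schurStar θ) M := RTwist.mk (schurStar θ) (ι 1)
    -- Test `G` on the functional of ι 1 restricted to `Q`: it corresponds to ι(f^*) in M_R, which
    -- `g` sends to x times the element of e S e given by w⁻¹ f w, and this is nonzero.
    have h1 : RDual.map (schurStar θ) p (RDual.map (schurStar θ) i (h.twistEquivDual m)) =
        h.twistEquivDual (RTwist.mk (schurStar θ) (ι (σ f).unop)) := RDual.ext fun y => by
      rw [RDual.map_form_apply, RDual.map_form_apply, h.twistEquivDual_form, hf,
        h.twistEquivDual_form, map_smul, RDual.smul_form_apply]
      change (θ y.val).form (σ f • ι 1) = (θ y.val).form (ι (σ f).unop)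
      rw [← MulOpposite.op_unop (σ f), op_smul_incl, one_mul, MulOpposite.unop_op]
    have h2 := LinearMap.congr_fun hG (RDual.map (schurStar θ) i (h.twistEquivDual m))
    rw [LinearMap.comp_apply, LinearMap.comp_apply, h1, LinearEquiv.coe_coe,
      LinearEquiv.symm_apply_apply] at h2
    change MulOpposite.op (adj θ' (homOf π (ι (σ f).unop))) • x = 0 at h2
    rw [← hwf, h.symm.adj_adj] at h2
    exact hx h2
  have := h.projective_twist hπι
  have : Module.Projective (SchurAlg A M)ᵐᵒᵖ
      (RDual (schurStar θ) (RTwist (schurStar θ) M)) :=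
    Module.Projective.of_equiv h.twistEquivDual
  have : Module.Projective (SchurAlg A M)ᵐᵒᵖ (RDual (schurStar θ) Q) :=
    Module.Projective.of_split (RDual.map (schurStar θ) p) (RDual.map (schurStar θ) i)
      (LinearMap.ext fun φ => RDual.ext fun y => by
        rw [LinearMap.comp_apply, RDual.map_form_apply, RDual.map_form_apply, hpi',
          LinearMap.id_apply])
  have : FiniteDimensional K Q := FiniteDimensional.of_surjective (p.restrictScalars K) fun y =>
    ⟨i y, hpi' y⟩
  obtain ⟨t, ht⟩ := hq.exists_surjective G hG
  have hinj : Function.Injective (t.restrictScalars K) :=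
    (LinearMap.injective_iff_surjective_of_finrank_eq_finrank
      (RDual.finrank_eq (K := K) (σ := schurStar θ) (X := Q))).2 ht
  exact ⟨(LinearEquiv.ofBijective t ⟨hinj, ht⟩).symm⟩

end SelfDual

end SchurPair

/-! ### The equivalences. -/

open SchurPair in
theorem theoremT {K : Type u} [Field K] {A : Type v} [Ring A] [Algebra K A]
    {M : Type w} [AddCommGroup M] [Module K M] [Module Aᵐᵒᵖ M] [IsScalarTower K Aᵐᵒᵖ M]
    -- the Schur pair `(A, M)` with `A` symmetric
    (hAM : IsSchurPair K A M) (hsym : IsSymmetricAlgebra K A)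
    -- it is self-dual: an anti-involution of `A` and a fixed isomorphism `θ : M ≅ M^*`
    (σ : A →ₐ[K] Aᵐᵒᵖ) (hσ : IsAntiInvolution σ) (θ : M ≃ₗ[Aᵐᵒᵖ] RDual σ M)
    -- `A` is a direct summand of `M`, with projection `e = ι ∘ π`, and `e^* = e`
    (ι : A →ₗ[Aᵐᵒᵖ] M) (π : M →ₗ[Aᵐᵒᵖ] A) (hπι : π ∘ₗ ι = LinearMap.id)
    (he : adj θ (ι ∘ₗ π) = ι ∘ₗ π)
    -- the simple right `S`-modules `L i`
    {P : Type p} (L : P → Type w) [∀ i, AddCommGroup (L i)] [∀ i, Module K (L i)]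
    [∀ i, Module (SchurAlg A M)ᵐᵒᵖ (L i)] [∀ i, IsScalarTower K (SchurAlg A M)ᵐᵒᵖ (L i)]
    (hL : IsCompleteSimples (B := SchurAlg A M) L)
    -- their projective covers `Q i`
    (Q : P → Type w) [∀ i, AddCommGroup (Q i)] [∀ i, Module K (Q i)]
    [∀ i, Module (SchurAlg A M)ᵐᵒᵖ (Q i)] [∀ i, IsScalarTower K (SchurAlg A M)ᵐᵒᵖ (Q i)]
    (q : ∀ i, Q i →ₗ[(SchurAlg A M)ᵐᵒᵖ] L i) (hq : ∀ i, IsProjectiveCover (q i))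
    -- the simple right `A`-modules `D i = F(L i)` are self-dual
    (hD : ∀ i ∈ nonzeroSet K A M L, IsSelfDual σ (Fun K A M (L i)))
    (i : P) :
    List.TFAE [
      i ∈ nonzeroSet K A M L,
      Nontrivial (Fun K A M (L i)),
      IsIsoToSubmodule (SchurAlg A M)ᵐᵒᵖ (L i) (RTwist (schurStar θ) M),
      IsIsoToSummand (SchurAlg A M)ᵐᵒᵖ (Q i) (RTwist (schurStar θ) M),
      Module.Projective (SchurAlg A M)ᵐᵒᵖ (Q i) ∧ Module.Injective (SchurAlg A M)ᵐᵒᵖ (Q i),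
      IsSelfDual (schurStar θ) (Q i)] := by
  have hfA := hAM.finite_algebra
  have hfM := hAM.finite_module
  obtain ⟨θ', hθ⟩ := exists_isTranspose hσ θ
  have hsimple := hL.simple i
  have hproj := (hq i).1
  have hF : Nontrivial (Fun K A M (L i)) ↔ _ := Fun.nontrivial_iff (L i) hπι
  have hhom : ∀ g : RTwist (schurStar θ) M →ₗ[(SchurAlg A M)ᵐᵒᵖ] L i, g ≠ 0 →
      Nontrivial (Fun K A M (L i)) := fun g hg => by
    rw [hF]
    by_contra! hz
    exact hg (eq_zero_of_smul_idempotent_eq_zero hθ hπι he hz g)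
  tfae_have 1 ↔ 2 := Iff.rfl
  tfae_have 3 ↔ 2 := (hθ.isIsoToSubmodule_iff hπι he).trans hF.symm
  tfae_have 2 → 4 := fun h => by
    obtain ⟨x, hx⟩ := hF.1 h
    have he' : adj θ' (homOf π (ι 1)) = homOf π (ι 1) := by
      rw [homOf_incl_one]
      conv_lhs => rw [← he, hθ.symm.adj_adj]
    have := hθ.projective_twist hπι
    -- The map M_R → L attached to x sends ι 1 to x e ≠ 0, because e is also fixed by the inverse
    -- star.
    obtain ⟨p, hp⟩ := (hq i).exists_surjective (hθ.twistHom π x) fun hg => hx <| by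
      have h1 := LinearMap.congr_fun hg (RTwist.mk (schurStar θ) (ι 1))
      rw [hθ.twistHom_apply] at h1
      change MulOpposite.op (adj θ' (homOf π (ι 1))) • x = 0 at h1
      rwa [he'] at h1
    obtain ⟨j, hj⟩ := Module.projective_lifting_property p LinearMap.id hp
    exact ⟨j, p, hj⟩
  tfae_have 4 → 6 := fun h => by
    refine isSelfDual_of_isIsoToSummand hsym hσ hθ hπι he (hq i) (hD i ?_) h
    obtain ⟨j, p, hpj⟩ := h
    refine hhom (q i ∘ₗ p) fun h0 => ?_
    obtain ⟨x, hx⟩ := @exists_ne (L i) (IsSimpleModule.nontrivial (SchurAlg A M)ᵐᵒᵖ (L i)) 0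
    obtain ⟨y, rfl⟩ := (hq i).2.1 x
    refine hx ?_
    have h1 := LinearMap.congr_fun h0 (j y)
    rwa [LinearMap.comp_apply, ← LinearMap.comp_apply p, hpj] at h1
  tfae_have 6 → 5 := fun ⟨Φ⟩ =>
    ⟨hproj, RDual.injective_of_projective hθ.bijective_schurStar Φ⟩
  tfae_have 5 → 2 := fun h => by
    obtain ⟨g, hg⟩ := hθ.exists_hom_ne_zero_of_injective (hq i) h.2
    exact hhom g hg
  tfae_finish
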